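/- Let $p$ be a prime, $k \ge 1$ an integer, $P(t) \in (\mathbb{Z}/p^k\mathbb{Z})[t]$ a monic polynomial, $R := (\mathbb{Z}/p^k\mathbb{Z})[t]/(P(t))$, and write $\bar t \in R$ for the image of $t$. Let $G$ be any finite $R$-module and let $0 < \epsilon < 1$ be a real number. A probability measure on $\mathbb{Z}/p^k\mathbb{Z}$ is called $\epsilon$-balanced if $\mathrm{Prob}(x \equiv a \bmod p) \le 1 - \epsilon$ for every $a \in \mathbb{F}_p$; a probability measure on the set $\mathrm{M}_n(\mathbb{Z}/p^k\mathbb{Z})$ of $n \times n$ matrices is called $\epsilon$-balanced if the $n^2$ entries of a random matrix are independent and each follows an $\epsilon$-balanced measure on $\mathbb{Z}/p^k\mathbb{Z}$ (the entries need not be identically distributed, and the measures for different $n$ need not be related). For each $n$, let an $\epsilon$-balanced probability measure on $\mathrm{M}_n(\mathbb{Z}/p^k\mathbb{Z})$ be given. Then \[\lim_{n \to \infty} \mathbb{E}_{X \in \mathrm{M}_n(\mathbb{Z}/p^k\mathbb{Z})} \bigl|\mathrm{Sur}_R\bigl(\mathrm{cok}_R(X - \bar t I_n), G\bigr)\bigr|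 = 1,\] where $\mathrm{cok}_R(Y) := R^n / Y R^n$ for a matrix $Y \in \mathrm{M}_n(R)$, and $\mathrm{Sur}_R(M, G)$ denotes the set of surjective $R$-linear maps from $M$ to $G$. -/

import Mathlib

open MeasureTheory ProbabilityTheory Filter Topology Polynomial

/-- The product σ-algebra on matrices. -/
instance Matrix.entrywiseMeasurableSpace (m n α : Type*) [MeasurableSpace α] :
    MeasurableSpace (Matrix m n α) :=
  inferInstanceAs (MeasurableSpace (m → n → α))

/-- For finite matrices over `ℤ/N` this is the discrete σ-algebra. -/
instance Matrix.zmodDiscreteMeasurableSpace (m n : Type*) [Finite m] [Finite n] (N : ℕ) [NeZero N] :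
    DiscreteMeasurableSpace (Matrix m n (ZMod N)) :=
  inferInstanceAs (DiscreteMeasurableSpace (m → n → ZMod N))

/-- An `ε`-balanced measure on `ℤ/p^k` (`k ≥ 1`): a probability measure under which every residue
class modulo `p` has probability at most `1 - ε`. -/
structure IsBalanced {p k : ℕ} (hk : k ≠ 0) (ε : ℝ) (ν : Measure (ZMod (p ^ k))) : Prop where
  isProbabilityMeasure : IsProbabilityMeasure ν
  residue_le : ∀ a : ZMod p,
    ν.real {x | ZMod.castHom (dvd_pow_self p hk) (ZMod p) x = a} ≤ 1 - ε

/-- An `ε`-balanced measure on `M_n(ℤ/p^k)`: a probability measure under which the `n²` entries are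
independent, and each entry has an `ε`-balanced law (the laws of the entries may differ). -/
structure IsBalancedMatrix {p k n : ℕ} (hk : k ≠ 0) (ε : ℝ)
    (μ : Measure (Matrix (Fin n) (Fin n) (ZMod (p ^ k)))) : Prop where
  isProbabilityMeasure : IsProbabilityMeasure μ
  indep : iIndepFun
    (fun (ij : Fin n × Fin n) (X : Matrix (Fin n) (Fin n) (ZMod (p ^ k))) => X ij.1 ij.2) μ
  balanced : ∀ i j : Fin n,
    IsBalanced hk ε (μ.map (fun X : Matrix (Fin n) (Fin n) (ZMod (p ^ k)) => X i j))

/-- The cokernel `Rⁿ / A Rⁿ` of a square matrix `A` over a commutative ring `R`. -/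
abbrev Matrix.Cok {R : Type*} [CommRing R] {n : ℕ} (A : Matrix (Fin n) (Fin n) R) : Type _ :=
  (Fin n → R) ⧸ LinearMap.range A.mulVecLin

/-- The matrix `X - t̄ I_n` over `A[t]/(P(t))`, for a square matrix `X` over `A`. -/
noncomputable def Matrix.subRoot {A : Type*} [CommRing A] (P : A[X]) {n : ℕ}
    (X : Matrix (Fin n) (Fin n) A) : Matrix (Fin n) (Fin n) (AdjoinRoot P) :=
  X.map (AdjoinRoot.of P) - AdjoinRoot.root P • (1 : Matrix (Fin n) (Fin n) (AdjoinRoot P))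

/-- The number of surjective `R`-linear maps from `M` onto `G`. -/
noncomputable def surjCount (R M G : Type*) [CommRing R] [AddCommGroup M] [Module R M]
    [AddCommGroup G] [Module R G] : ℕ :=
  Nat.card {f : M →ₗ[R] G // Function.Surjective f}

/-! A surjection from the cokernel onto `G` is a tuple `v` in `Gⁿ` that generates `G` and satisfies
`∑ i, X i j • v i = t̄ • v j` for every `j`. These relations make the `ℤ/p^k`-span of `v` stable
under `t̄`, so generating over `R` is the same as generating over `ℤ/p^k` (`surjCount_cok_subRoot`).
Independence then turns the expectation into a sum over generating `v` of products of column
probabilities (`IsBalancedMatrix.integral_card_eq`). All estimates are uniform in the target `t̄ • v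
j`, which is why an arbitrary map `T` replaces it.

If `v` still generates after any `m` entries are deleted, Fourier analysis puts each column
probability within `c ^ m` of `1/|G|`, for some `c < 1` (`abs_combProb_sub_le`). Almost all of the
`|G|ⁿ` tuples are of this kind, and together they contribute about 1.

For any other `v`, some proper submodule `H` is robustly spanned by `v` and contains all but at most
`m|G|` entries. At most `|H|ⁿ|G|^|σ|` tuples have exceptional set inside `σ`, while each column
probability is at most `(1 - ε)/|H| + c ^ m`, because a generating tuple has an entry outside `H`.
The powers of `|H|` cancel and leave `rⁿ` with `r < 1`. Taking `m = n / K` with `K` large makes this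
beat the number of choices of `σ` (`exists_tendsto_smallSetSum_mul_pow`). -/

/-- A probability vector on `ℤ/p^k` giving every residue class modulo `p` mass at most `1 - ε`. -/
structure BalancedWeight {p k : ℕ} [Fact p.Prime] (hk : k ≠ 0) (ε : ℝ) (w : ZMod (p ^ k) → ℝ) :
    Prop where
  nonneg : ∀ a, 0 ≤ w a
  sum_eq_one : ∑ a, w a = 1
  residue_le : ∀ r : ZMod p,
    ∑ a with ZMod.castHom (dvd_pow_self p hk) (ZMod p) a = r, w a ≤ 1 - ε

open scoped Classical in
/-- The probability that `∑ i, x i • v i ∈ S` when the `x i` are independent with laws `w i`. -/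
noncomputable def combProb {ι A G : Type*} [Fintype ι] [Fintype A] [DecidableEq ι] [AddCommMonoid G] [SMul A G]
    (w : ι → A → ℝ) (v : ι → G) (S : Set G) : ℝ :=
  ∑ x : ι → A with ∑ i, x i • v i ∈ S, ∏ i, w i (x i)

lemma AddChar.map_sum_eq_prod {ι A M : Type*} [AddCommMonoid A] [CommMonoid M] (ψ : AddChar A M)
    (s : Finset ι) (f : ι → A) : ψ (∑ i ∈ s, f i) = ∏ i ∈ s, ψ (f i) := by
  classical
  induction s using Finset.induction_on with
  | empty => simp
  | insert i s hi ih => rw [Finset.sum_insert hi, Finset.prod_insert hi, map_add_eq_mul, ih]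

/-! ### Character sums of balanced laws -/

section CharacterBounds

variable {p k : ℕ} [Fact p.Prime]

lemma ZMod.isUnit_of_castHom_ne_zero (hk : k ≠ 0) {a : ZMod (p ^ k)}
    (ha : ZMod.castHom (dvd_pow_self p hk) (ZMod p) a ≠ 0) : IsUnit a := by
  rw [← ZMod.natCast_zmod_val a] at ha ⊢
  rw [ZMod.isUnit_iff_coprime]
  refine Nat.Coprime.pow_right _ (Nat.Coprime.symm ?_)
  rw [(Fact.out : p.Prime).coprime_iff_not_dvd]
  rwa [map_natCast, Ne, ZMod.natCast_eq_zero_iff] at ha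

lemma AddChar.apply_ne_one_of_isUnit {N : ℕ} [NeZero N] {χ : AddChar (ZMod N) ℂ} (hχ : χ ≠ 1)
    {a : ZMod N} (ha : IsUnit a) : χ a ≠ 1 := by
  intro h
  obtain ⟨u, rfl⟩ := ha
  apply hχ
  ext b
  have hb : b = (b * ↑u⁻¹).val • (u : ZMod N) := by
    rw [nsmul_eq_mul, ZMod.natCast_zmod_val, mul_assoc, Units.inv_mul, mul_one]
  rw [hb, AddChar.map_nsmul_eq_pow, h, one_pow, AddChar.one_apply]

/-- There are finitely many pairs of a character and a point, and a value on the unit circle other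
than 1 has real part below 1. -/
lemma AddChar.exists_re_le (A : Type*) [AddCommGroup A] [Finite A] :
    ∃ η : ℝ, 0 < η ∧ ∀ (χ : AddChar A ℂ) (a : A), χ a ≠ 1 → (χ a).re ≤ 1 - η := by
  have hfin : Finite {q : AddChar A ℂ × A // q.1 q.2 ≠ 1} := inferInstance
  rcases isEmpty_or_nonempty {q : AddChar A ℂ × A // q.1 q.2 ≠ 1} with he | hne
  · exact ⟨1, one_pos, fun χ a h => (he.false ⟨(χ, a), h⟩).elim⟩
  · obtain ⟨q, hq⟩ := Finite.exists_max
      (fun q : {q : AddChar A ℂ × A // q.1 q.2 ≠ 1} => (q.1.1 q.1.2).re)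
    refine ⟨1 - (q.1.1 q.1.2).re, ?_, fun χ a h => ?_⟩
    · have hn : ‖q.1.1 q.1.2‖ = 1 := AddChar.norm_apply _ _
      have hle := Complex.re_le_norm (q.1.1 q.1.2)
      refine sub_pos.2 (lt_of_le_of_ne (hn ▸ hle) fun h => q.2 ?_)
      have := Complex.re_eq_norm.1 (h.trans hn.symm)
      refine Complex.ext h ?_
      simpa using (Complex.nonneg_iff.1 this).2.symm
    · have := hq ⟨(χ, a), h⟩
      simp only at this
      linarith

/-- The squared norm is the expectation of `χ (a - b)` for independent `a`, `b` of law `w`. With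
probability at least `ε` they differ modulo `p`; then `a - b` is a unit, so `χ (a - b) ≠ 1` and its
real part loses a fixed `η`. The bound depends neither on `w` nor on `χ`. -/
lemma BalancedWeight.exists_norm_le (p k : ℕ) [Fact p.Prime] (hk : k ≠ 0) {ε : ℝ} (hε : 0 < ε) :
    ∃ c : ℝ, 0 ≤ c ∧ c < 1 ∧ ∀ w : ZMod (p ^ k) → ℝ, BalancedWeight hk ε w →
      ∀ χ : AddChar (ZMod (p ^ k)) ℂ, χ ≠ 1 → ‖∑ a, (w a : ℂ) * χ a‖ ≤ c := by
  obtain ⟨η, hη, hre⟩ := AddChar.exists_re_le (ZMod (p ^ k))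
  refine ⟨√(1 - ε * η), Real.sqrt_nonneg _, ?_, fun w hw χ hχ => ?_⟩
  · rw [Real.sqrt_lt' one_pos]
    nlinarith [mul_pos hε hη]
  apply Real.le_sqrt_of_sq_le
  set f := ZMod.castHom (dvd_pow_self p hk) (ZMod p)
  have hsq : ‖∑ a, (w a : ℂ) * χ a‖ ^ 2 = ∑ a, ∑ b, w a * w b * (χ (a - b)).re := by
    have h1 : ((‖∑ a, (w a : ℂ) * χ a‖ ^ 2 : ℝ) : ℂ) = ∑ a, ∑ b, (w a * w b : ℂ) * χ (a - b) := by
      push_cast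
      rw [← Complex.mul_conj', map_sum, Finset.sum_mul_sum]
      refine Finset.sum_congr rfl fun a _ => Finset.sum_congr rfl fun b _ => ?_
      rw [map_mul, Complex.conj_ofReal, sub_eq_add_neg, AddChar.map_add_eq_mul,
        AddChar.map_neg_eq_conj]
      ring
    have h2 := congrArg Complex.re h1
    rw [Complex.ofReal_re] at h2
    rw [h2, Complex.re_sum]
    refine Finset.sum_congr rfl fun a _ => ?_
    rw [Complex.re_sum]
    refine Finset.sum_congr rfl fun b _ => ?_
    rw [← Complex.ofReal_mul, Complex.re_ofReal_mul]
  have hterm : ∀ a b, (χ (a - b)).re ≤ 1 - η + η * (if f b = f a then 1 else 0) := by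
    intro a b
    split_ifs with h
    · have := Complex.re_le_norm (χ (a - b))
      rw [AddChar.norm_apply] at this
      linarith
    · rw [mul_zero, add_zero]
      refine hre χ _ (AddChar.apply_ne_one_of_isUnit hχ (ZMod.isUnit_of_castHom_ne_zero hk ?_))
      rw [map_sub, sub_ne_zero]
      exact fun h' => h h'.symm
  calc ‖∑ a, (w a : ℂ) * χ a‖ ^ 2 = ∑ a, ∑ b, w a * w b * (χ (a - b)).re := hsq
    _ ≤ ∑ a, ∑ b, w a * w b * (1 - η + η * (if f b = f a then 1 else 0)) := by
        gcongr with a _ b _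
        · exact mul_nonneg (hw.nonneg a) (hw.nonneg b)
        · exact hterm a b
    _ = ∑ a, w a * ((1 - η) * ∑ b, w b + η * ∑ b with f b = f a, w b) := by
        refine Finset.sum_congr rfl fun a _ => ?_
        rw [Finset.sum_filter, Finset.mul_sum, Finset.mul_sum, ← Finset.sum_add_distrib,
          Finset.mul_sum]
        refine Finset.sum_congr rfl fun b _ => ?_
        split_ifs <;> ring
    _ ≤ ∑ a, w a * ((1 - η) * 1 + η * (1 - ε)) := by
        rw [hw.sum_eq_one]
        gcongr with a _
        · exact hw.nonneg a
        · exact hw.residue_le _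
    _ = 1 - ε * η := by
        rw [← Finset.sum_mul, hw.sum_eq_one]
        ring

end CharacterBounds

/-! ### Fourier inversion relative to a subgroup -/

section Fourier

variable {G : Type*} [AddCommGroup G] [Fintype G]

open scoped Classical in
/-- Fourier expansion of the difference between a point mass and the uniform mass on a subgroup. -/
lemma AddChar.indicator_sub_eq_sum (H : AddSubgroup G) (y : G) :
    (if y = 0 then 1 else 0 : ℂ) - (Nat.card H : ℂ)⁻¹ * (if y ∈ H then 1 else 0) =
      (Nat.card G : ℂ)⁻¹ * ∑ χ : AddChar G ℂ with ∃ h ∈ H, χ h ≠ 1, χ y := by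
  have hG : (Nat.card G : ℂ) ≠ 0 := Nat.cast_ne_zero.2 Nat.card_pos.ne'
  have hH : (Nat.card H : ℂ) ≠ 0 := Nat.cast_ne_zero.2 Nat.card_pos.ne'
  have hsum : ∀ z : G, ∑ χ : AddChar G ℂ, χ z = (Nat.card G : ℂ) * if z = 0 then 1 else 0 := by
    intro z
    rw [AddChar.sum_apply_eq_ite, Nat.card_eq_fintype_card, mul_ite, mul_one, mul_zero]
  have htriv : ∀ χ : AddChar G ℂ, ∑ h : H, χ (h : G) =
      (Nat.card H : ℂ) * if ∃ h ∈ H, χ h ≠ 1 then 0 else 1 := by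
    intro χ
    have := AddChar.sum_eq_ite (χ.compAddMonoidHom H.subtype)
    have hiff : χ.compAddMonoidHom H.subtype = 0 ↔ ¬ ∃ h ∈ H, χ h ≠ 1 := by
      rw [AddChar.eq_zero_iff]
      push Not
      simp
    simp only [AddChar.compAddMonoidHom_apply, AddSubgroup.coe_subtype, hiff] at this
    rw [this, Nat.card_eq_fintype_card]
    split_ifs <;> simp_all
  have hsub : ∑ χ : AddChar G ℂ with ¬ ∃ h ∈ H, χ h ≠ 1, χ y =
      (Nat.card H : ℂ)⁻¹ * ((Nat.card G : ℂ) * if y ∈ H then 1 else 0) := by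
    -- By `htriv`, summing `χ (y + h)` over `H` keeps exactly the characters trivial on `H`;
    -- orthogonality over all `χ` then leaves only `h = -y`.
    rw [eq_inv_mul_iff_mul_eq₀ hH, Finset.mul_sum]
    calc ∑ χ : AddChar G ℂ with ¬ ∃ h ∈ H, χ h ≠ 1, (Nat.card H : ℂ) * χ y
        = ∑ χ : AddChar G ℂ, ∑ h : H, χ (y + h) := by
          rw [Finset.sum_filter]
          refine Finset.sum_congr rfl fun χ _ => ?_
          simp only [AddChar.map_add_eq_mul]
          rw [← Finset.mul_sum, htriv]
          split_ifs <;> simp_all [mul_comm]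
      _ = (Nat.card G : ℂ) * ∑ h : H, if y + h = 0 then 1 else 0 := by
          rw [Finset.sum_comm, Finset.mul_sum]
          exact Finset.sum_congr rfl fun h _ => hsum _
      _ = (Nat.card G : ℂ) * if y ∈ H then 1 else 0 := by
          congr 1
          split_ifs with hy
          · rw [Finset.sum_eq_single ⟨-y, H.neg_mem hy⟩]
            · simp
            · intro b _ hb
              rw [if_neg]
              intro h0
              exact hb (Subtype.ext (eq_neg_of_add_eq_zero_right h0))
            · simp
          · refine Finset.sum_eq_zero fun b _ => if_neg fun h0 => hy ?_
            rw [eq_neg_of_add_eq_zero_left h0]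
            exact H.neg_mem b.2
  have hsplit := Finset.sum_filter_add_sum_filter_not (Finset.univ : Finset (AddChar G ℂ))
    (fun χ => ∃ h ∈ H, χ h ≠ 1) (fun χ => χ y)
  rw [hsub, hsum] at hsplit
  rw [eq_sub_of_add_eq hsplit]
  field_simp

end Fourier

/-! ### Elementary facts on product weights -/

section CombProb

variable {ι A G : Type*} [Fintype ι] [Fintype A] [DecidableEq ι]

lemma combProb_nonneg [AddCommMonoid G] [SMul A G] {w : ι → A → ℝ} (hw : ∀ i a, 0 ≤ w i a)
    (v : ι → G) (S : Set G) : 0 ≤ combProb w v S :=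
  Finset.sum_nonneg fun _ _ => Finset.prod_nonneg fun _ _ => hw _ _

lemma sum_prod_weight {R : Type*} [CommSemiring R] (w : ι → A → R) :
    ∑ x : ι → A, ∏ i, w i (x i) = ∏ i, ∑ a, w i a := by
  rw [Finset.prod_univ_sum, Fintype.piFinset_univ]

end CombProb

/-! ### Distribution of a random combination of a fixed tuple -/

section Balanced

variable {p k : ℕ} [Fact p.Prime] {hk : k ≠ 0} {ε : ℝ} {ι : Type*} [Fintype ι] [DecidableEq ι]
  {G : Type*} [AddCommGroup G] [Module (ZMod (p ^ k)) G] {w : ι → ZMod (p ^ k) → ℝ}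

open scoped Classical in
/-- If every character nontrivial on `H` is nontrivial on at least `m` of the `v i`, then
`∑ i, x i • v i` is almost uniformly distributed in its coset of `H`. -/
lemma abs_combProb_sub_le [Finite G] {c : ℝ} (hc0 : 0 ≤ c) (hc1 : c ≤ 1)
    (hc : ∀ w : ZMod (p ^ k) → ℝ, BalancedWeight hk ε w →
      ∀ χ : AddChar (ZMod (p ^ k)) ℂ, χ ≠ 1 → ‖∑ a, (w a : ℂ) * χ a‖ ≤ c)
    (hw : ∀ i, BalancedWeight hk ε (w i)) (v : ι → G) (H : AddSubgroup G) (m : ℕ)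
    (hm : ∀ χ : AddChar G ℂ, (∃ h ∈ H, χ h ≠ 1) → m ≤ (Finset.univ.filter (fun i => χ (v i) ≠ 1)).card)
    (g : G) :
    |combProb w v {g} - (Nat.card H : ℝ)⁻¹ * combProb w v {y | y - g ∈ H}| ≤ c ^ m := by
  have := Fintype.ofFinite G
  have hG : (0 : ℝ) < Nat.card G := Nat.cast_pos.2 Nat.card_pos
  have hfac : ∀ (χ : AddChar G ℂ) (i : ι),
      ‖∑ a, (w i a : ℂ) * χ (a • v i)‖ ≤ if χ (v i) ≠ 1 then c else 1 := by
    intro χ i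
    split_ifs with h
    -- The pullback of `χ` along `a ↦ a • v i` is a character of `ℤ/p^k` with value `χ (v i) ≠ 1` at
    -- 1.
    · refine hc (w i) (hw i)
        (χ.compAddMonoidHom (LinearMap.toSpanSingleton (ZMod (p ^ k)) G (v i)).toAddMonoidHom) ?_
      intro h1
      apply h
      have := DFunLike.congr_fun h1 1
      simpa using this
    · calc ‖∑ a, (w i a : ℂ) * χ (a • v i)‖ ≤ ∑ a, ‖(w i a : ℂ) * χ (a • v i)‖ :=
            norm_sum_le _ _
        _ = ∑ a, w i a := by
            refine Finset.sum_congr rfl fun a _ => ?_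
            rw [norm_mul, AddChar.norm_apply, mul_one, Complex.norm_real, Real.norm_eq_abs,
              abs_of_nonneg ((hw i).nonneg a)]
        _ ≤ 1 := (hw i).sum_eq_one.le
  have key : ((combProb w v {g} - (Nat.card H : ℝ)⁻¹ * combProb w v {y | y - g ∈ H} : ℝ) : ℂ) =
      (Nat.card G : ℂ)⁻¹ * ∑ χ : AddChar G ℂ with ∃ h ∈ H, χ h ≠ 1,
        χ (-g) * ∏ i, ∑ a, (w i a : ℂ) * χ (a • v i) := by
    have hx : ∀ χ : AddChar G ℂ, χ (-g) * ∏ i, ∑ a, (w i a : ℂ) * χ (a • v i) =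
        ∑ x : ι → ZMod (p ^ k), (∏ i, (w i (x i) : ℂ)) * χ (∑ i, x i • v i - g) := by
      intro χ
      rw [← sum_prod_weight (fun i a => (w i a : ℂ) * χ (a • v i)), Finset.mul_sum]
      refine Finset.sum_congr rfl fun x _ => ?_
      rw [Finset.prod_mul_distrib, sub_eq_add_neg, AddChar.map_add_eq_mul,
        AddChar.map_sum_eq_prod]
      ring
    simp only [hx]
    rw [Finset.sum_comm, Finset.mul_sum]
    simp only [combProb]
    push_cast
    rw [Finset.sum_filter, Finset.sum_filter, Finset.mul_sum, ← Finset.sum_sub_distrib]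
    refine Finset.sum_congr rfl fun x _ => ?_
    rw [← Finset.mul_sum, mul_left_comm, ← AddChar.indicator_sub_eq_sum H]
    simp only [Set.mem_singleton_iff, Set.mem_ofPred_eq, sub_eq_zero]
    split_ifs <;> ring
  rw [← Real.norm_eq_abs, ← Complex.norm_real, key, norm_mul, norm_inv, Complex.norm_natCast,
    inv_mul_le_iff₀ hG]
  calc ‖∑ χ : AddChar G ℂ with ∃ h ∈ H, χ h ≠ 1,
        χ (-g) * ∏ i, ∑ a, (w i a : ℂ) * χ (a • v i)‖
      ≤ ∑ χ : AddChar G ℂ with ∃ h ∈ H, χ h ≠ 1, c ^ m := by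
        refine norm_sum_le_of_le _ fun χ hχ => ?_
        rw [norm_mul, AddChar.norm_apply, one_mul, norm_prod]
        calc ∏ i, ‖∑ a, (w i a : ℂ) * χ (a • v i)‖ ≤ ∏ i, if χ (v i) ≠ 1 then c else 1 :=
              Finset.prod_le_prod (fun _ _ => norm_nonneg _) fun i _ => hfac χ i
          _ = c ^ (Finset.univ.filter (fun i => χ (v i) ≠ 1)).card := by
              rw [Finset.prod_ite, Finset.prod_const, Finset.prod_const_one, mul_one]
          _ ≤ c ^ m := pow_le_pow_of_le_one hc0 hc1 (hm χ (Finset.mem_filter.1 hχ).2)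
    _ ≤ ∑ χ : AddChar G ℂ, c ^ m :=
        Finset.sum_le_sum_of_subset_of_nonneg (Finset.filter_subset _ _)
          fun _ _ _ => pow_nonneg hc0 m
    _ = Nat.card G * c ^ m := by
        rw [Finset.sum_const, nsmul_eq_mul, Finset.card_univ, AddChar.card_eq,
          Nat.card_eq_fintype_card]

lemma combProb_univ (hw : ∀ i, BalancedWeight hk ε (w i)) (v : ι → G) :
    combProb w v Set.univ = 1 := by
  simp only [combProb, Set.mem_univ, Finset.filter_true]
  rw [sum_prod_weight]
  exact Finset.prod_eq_one fun i _ => (hw i).sum_eq_one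

/-- If some `v i` lies outside `H`, then `∑ i, x i • v i` avoids each coset of `H` with probability
at least `ε`. -/
lemma combProb_coset_le (hw : ∀ i, BalancedWeight hk ε (w i)) (v : ι → G)
    (H : Submodule (ZMod (p ^ k)) G) {i : ι} (hi : v i ∉ H) (g : G) :
    combProb w v {y | y - g ∈ H} ≤ 1 - ε := by
  classical
  set f := ZMod.castHom (dvd_pow_self p hk) (ZMod p)
  have hinner : ∀ u : G, ∑ a, (if a • v i + u - g ∈ H then w i a else 0) ≤ 1 - ε := by
    intro u
    -- With the other coordinates frozen in `u`, all admissible `a` share one residue modulo `p`: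
    -- otherwise a difference of two would be a unit, forcing `v i ∈ H`.
    by_cases hex : ∃ a₀ : ZMod (p ^ k), a₀ • v i + u - g ∈ H
    · obtain ⟨a₀, ha₀⟩ := hex
      refine le_trans ?_ ((hw i).residue_le (f a₀))
      rw [Finset.sum_filter]
      refine Finset.sum_le_sum fun a _ => ?_
      by_cases h1 : a • v i + u - g ∈ H
      · rw [if_pos h1, if_pos]
        by_contra hne
        have hu : IsUnit (a - a₀) := ZMod.isUnit_of_castHom_ne_zero hk (by
          rwa [map_sub, sub_ne_zero])
        apply hi
        have h2 : (a - a₀) • v i ∈ H := by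
          have := H.sub_mem h1 ha₀
          rwa [sub_sub_sub_cancel_right, add_sub_add_right_eq_sub, ← sub_smul] at this
        exact (H.smul_mem_iff_of_isUnit hu).1 h2
      · rw [if_neg h1]
        split_ifs
        exacts [(hw i).nonneg a, le_rfl]
    · push Not at hex
      simp only [hex, if_false, Finset.sum_const_zero]
      refine le_trans ?_ ((hw i).residue_le 0)
      exact Finset.sum_nonneg fun a _ => (hw i).nonneg a
  calc combProb w v {y | y - g ∈ H}
      = ∑ x : ι → ZMod (p ^ k), if ∑ j, x j • v j - g ∈ H then ∏ j, w j (x j) else 0 := by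
        rw [combProb, Finset.sum_filter]
        rfl
    _ = ∑ q : ZMod (p ^ k) × ({j // j ≠ i} → ZMod (p ^ k)),
          if q.1 • v i + ∑ j : {j // j ≠ i}, q.2 j • v j - g ∈ H then w i q.1 * ∏ j : {j // j ≠ i}, w j (q.2 j) else 0 := by
        refine Fintype.sum_equiv (Equiv.funSplitAt i _) _ _ fun x => ?_
        rw [Fintype.prod_eq_mul_prod_subtype_ne _ i, Fintype.sum_eq_add_sum_subtype_ne _ i]
        rfl
    _ = ∑ y : {j // j ≠ i} → ZMod (p ^ k), (∏ j : {j // j ≠ i}, w j (y j)) *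
          ∑ a, (if a • v i + ∑ j : {j // j ≠ i}, y j • v j - g ∈ H then w i a else 0) := by
        rw [Fintype.sum_prod_type, Finset.sum_comm]
        refine Finset.sum_congr rfl fun y _ => ?_
        rw [Finset.mul_sum]
        refine Finset.sum_congr rfl fun a _ => ?_
        split_ifs <;> ring
    _ ≤ ∑ y : {j // j ≠ i} → ZMod (p ^ k), (∏ j : {j // j ≠ i}, w j (y j)) * (1 - ε) := by
        gcongr with y _
        · exact Finset.prod_nonneg fun j _ => (hw j).nonneg _
        · exact hinner _
    _ = 1 - ε := by
        rw [← Finset.sum_mul, sum_prod_weight (fun j : {j // j ≠ i} => w j)]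
        simp only [(hw _).sum_eq_one, Finset.prod_const_one, one_mul]

end Balanced

/-! ### Robustly spanned submodules and counting of non-robust tuples -/

section Robust

variable {A G ι : Type*} [CommRing A] [AddCommGroup G] [Module A G]

/-- The span of the `v i` with `i ∉ σ`. -/
def spanOff (A : Type*) {G ι : Type*} [CommRing A] [AddCommGroup G] [Module A G] (v : ι → G)
    (σ : Finset ι) : Submodule A G :=
  Submodule.span A (v '' (σ : Set ι)ᶜ)

/-- `H` lies in the span of the `v i` even after deleting any `m` of them: the tuple `v` is a code
of distance more than `m` for `H`. -/
def IsRobust {A G ι : Type*} [CommRing A] [AddCommGroup G] [Module A G] (v : ι → G) (m : ℕ)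
    (H : Submodule A G) : Prop :=
  ∀ τ : Finset ι, τ.card ≤ m → H ≤ spanOff A v τ

lemma spanOff_anti (v : ι → G) {σ τ : Finset ι} (h : σ ⊆ τ) : spanOff A v τ ≤ spanOff A v σ :=
  Submodule.span_mono (Set.image_mono (Set.compl_subset_compl.2 (Finset.coe_subset.2 h)))

lemma mem_spanOff (v : ι → G) {σ : Finset ι} {i : ι} (hi : i ∉ σ) : v i ∈ spanOff A v σ :=
  Submodule.subset_span ⟨i, by simpa using hi, rfl⟩

open scoped Classical in
-- Greedy deletion: as long as removing some `m` further entries shrinks the span, remove them. The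
-- cardinality of the span drops each time, so at most `|G|` rounds occur.
lemma exists_isRobust_spanOff [Finite G] (v : ι → G) (m : ℕ) :
    ∃ σ : Finset ι, σ.card ≤ m * Nat.card G ∧ IsRobust v m (spanOff A v σ) := by
  have key : ∀ d : ℕ, ∀ σ : Finset ι, Nat.card (spanOff A v σ) ≤ d →
      ∃ σ' : Finset ι, σ'.card ≤ σ.card + m * d ∧ IsRobust v m (spanOff A v σ') := by
    intro d
    induction d with
    | zero => exact fun σ h => absurd (Nat.card_pos (α := spanOff A v σ)) (by omega)
    | succ d ih =>
      intro σ h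
      by_cases hσ : ∀ τ : Finset ι, τ.card ≤ m → spanOff A v σ ≤ spanOff A v (σ ∪ τ)
      · exact ⟨σ, Nat.le_add_right _ _, fun τ hτ =>
          (hσ τ hτ).trans (spanOff_anti v Finset.subset_union_right)⟩
      · push Not at hσ
        obtain ⟨τ, hτ, hlt⟩ := hσ
        have hlt' : spanOff A v (σ ∪ τ) < spanOff A v σ :=
          lt_of_le_not_ge (spanOff_anti v Finset.subset_union_left) hlt
        have hcard : Nat.card (spanOff A v (σ ∪ τ)) < Nat.card (spanOff A v σ) :=
          Set.Finite.card_lt_card (Set.toFinite _) hlt'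
        obtain ⟨σ', hσ', hr⟩ := ih (σ ∪ τ) (by omega)
        refine ⟨σ', ?_, hr⟩
        have := Finset.card_union_le σ τ
        rw [mul_add]
        omega
  obtain ⟨σ, hσ, hr⟩ := key (Nat.card G) ∅ (Nat.card_le_card_of_injective _ Subtype.val_injective)
  exact ⟨σ, by simpa using hσ, hr⟩

lemma IsRobust.exists_of_not_top [Finite G] {v : ι → G} {m : ℕ}
    (hv : ¬ IsRobust v m (⊤ : Submodule A G)) :
    ∃ H : Submodule A G, H ≠ ⊤ ∧ IsRobust v m H ∧
      ∃ σ : Finset ι, σ.card ≤ m * Nat.card G ∧ ∀ i ∉ σ, v i ∈ H := by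
  obtain ⟨σ, hσ, hr⟩ := exists_isRobust_spanOff (A := A) v m
  exact ⟨_, fun h => hv (h ▸ hr), hr, σ, hσ, fun i hi => mem_spanOff v hi⟩

lemma IsRobust.span_range_eq_top {v : ι → G} {m : ℕ} (hv : IsRobust v m (⊤ : Submodule A G)) :
    Submodule.span A (Set.range v) = ⊤ := by
  have := hv ∅ (by simp)
  rw [spanOff, Finset.coe_empty, Set.compl_empty, Set.image_univ] at this
  exact top_le_iff.1 this

variable [Fintype ι]

open scoped Classical in
-- Were there fewer than `m` such indices, deleting them would leave only entries in the kernel of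
-- `χ`, and by robustness this kernel would contain `H`.
lemma IsRobust.le_card_apply_ne_one {N : ℕ} [NeZero N] [Module (ZMod N) G] {v : ι → G} {m : ℕ}
    {H : Submodule (ZMod N) G} (hv : IsRobust v m H) (χ : AddChar G ℂ) (hχ : ∃ h ∈ H, χ h ≠ 1) :
    m ≤ (Finset.univ.filter (fun i => χ (v i) ≠ 1)).card := by
  by_contra! hlt
  obtain ⟨h, hH, hh⟩ := hχ
  apply hh
  have hmem := hv _ hlt.le hH
  let K : AddSubgroup G := χ.toAddMonoidHom.ker
  have hK : spanOff (ZMod N) v (Finset.univ.filter (fun i => χ (v i) ≠ 1)) ≤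
      AddSubgroup.toZModSubmodule N K := by
    refine Submodule.span_le.2 ?_
    rintro _ ⟨i, hi, rfl⟩
    simpa [K, AddMonoidHom.mem_ker] using hi
  have := hK hmem
  simpa [K, AddMonoidHom.mem_ker] using this

open scoped Classical in
lemma card_forall_notMem_le [DecidableEq ι] [Fintype G] (H : Submodule A G) (σ : Finset ι) :
    ((Finset.univ.filter fun v : ι → G => ∀ i ∉ σ, v i ∈ H).card : ℝ) ≤
      (Nat.card H : ℝ) ^ Fintype.card ι * (Nat.card G : ℝ) ^ σ.card := by
  have h1 : (Finset.univ.filter fun v : ι → G => ∀ i ∉ σ, v i ∈ H) =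
      Fintype.piFinset fun i => if i ∈ σ then Finset.univ else Finset.univ.filter (· ∈ H) := by
    ext v
    simp only [Finset.mem_filter, Finset.mem_univ, true_and, Fintype.mem_piFinset]
    refine forall_congr' fun i => ?_
    split_ifs with h <;> simp [h]
  have hH1 : (1 : ℝ) ≤ Nat.card H := Nat.one_le_cast.2 Nat.card_pos
  rw [h1, Fintype.card_piFinset, Nat.cast_prod]
  calc ∏ i, (((if i ∈ σ then Finset.univ else Finset.univ.filter (· ∈ H)) : Finset G).card : ℝ)
      ≤ ∏ i, ((Nat.card H : ℝ) * if i ∈ σ then (Nat.card G : ℝ) else 1) := by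
        refine Finset.prod_le_prod (fun _ _ => Nat.cast_nonneg _) fun i _ => ?_
        split_ifs
        · rw [Finset.card_univ, ← Nat.card_eq_fintype_card]
          exact le_mul_of_one_le_left (Nat.cast_nonneg _) hH1
        · rw [mul_one, Nat.card_eq_fintype_card, Fintype.card_subtype]
    _ = _ := by
        rw [Finset.prod_mul_distrib, Finset.prod_const, Finset.prod_ite_mem, Finset.univ_inter,
          Finset.prod_const, Finset.card_univ]

/-- The number of pairs of a set `σ` of at most `M` indices and a function on `σ` with `q` possible
values. -/
noncomputable def smallSetSum (ι : Type*) [Fintype ι] (q M : ℕ) : ℝ :=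
  ∑ σ : Finset ι with σ.card ≤ M, (q : ℝ) ^ σ.card

open scoped Classical in
-- A union bound over the submodule `H` and the exceptional set `σ` of `IsRobust.exists_of_not_top`;
-- the factor `|H|ⁿ` from counting tuples is absorbed by the hypothesis on `f`.
lemma sum_not_isRobust_le [DecidableEq ι] [Fintype G] (m : ℕ) (f : (ι → G) → ℝ) (hf : ∀ v, 0 ≤ f v) {B : ℝ} (hB0 : 0 ≤ B)
    (hB : ∀ (H : Submodule A G) (v : ι → G), H ≠ ⊤ → IsRobust v m H →
      (Nat.card H : ℝ) ^ Fintype.card ι * f v ≤ B) :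
    ∑ v : ι → G with ¬ IsRobust v m (⊤ : Submodule A G), f v ≤
      Nat.card (Submodule A G) * (smallSetSum ι (Nat.card G) (m * Nat.card G) * B) := by
  have := Fintype.ofFinite (Submodule A G)
  have hterm : ∀ H : Submodule A G, H ≠ ⊤ → ∀ σ : Finset ι,
      ∑ v : ι → G, (if IsRobust v m H ∧ ∀ i ∉ σ, v i ∈ H then f v else 0) ≤
        (Nat.card G : ℝ) ^ σ.card * B := by
    intro H hH σ
    have hHpos : (0 : ℝ) < (Nat.card H : ℝ) ^ Fintype.card ι :=
      pow_pos (Nat.cast_pos.2 Nat.card_pos) _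
    calc ∑ v : ι → G, (if IsRobust v m H ∧ ∀ i ∉ σ, v i ∈ H then f v else 0)
        ≤ ∑ v : ι → G with ∀ i ∉ σ, v i ∈ H, B / (Nat.card H : ℝ) ^ Fintype.card ι := by
          rw [Finset.sum_filter]
          refine Finset.sum_le_sum fun v _ => ?_
          by_cases hv : ∀ i ∉ σ, v i ∈ H
          · rw [if_pos hv]
            split_ifs with hr
            · rw [le_div_iff₀ hHpos, mul_comm]
              exact hB H v hH hr.1
            · positivity
          · rw [if_neg hv, if_neg fun h => hv h.2]
      _ = (Finset.univ.filter fun v : ι → G => ∀ i ∉ σ, v i ∈ H).card *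
            (B / (Nat.card H : ℝ) ^ Fintype.card ι) := by
          rw [Finset.sum_const, nsmul_eq_mul]
      _ ≤ (Nat.card H : ℝ) ^ Fintype.card ι * (Nat.card G : ℝ) ^ σ.card *
            (B / (Nat.card H : ℝ) ^ Fintype.card ι) := by
          gcongr
          exact card_forall_notMem_le H σ
      _ = (Nat.card G : ℝ) ^ σ.card * B := by
          field_simp
  set T : Finset (Finset ι) := Finset.univ.filter fun σ => σ.card ≤ m * Nat.card G with hT
  calc ∑ v : ι → G with ¬ IsRobust v m (⊤ : Submodule A G), f v
      ≤ ∑ v : ι → G, ∑ H : Submodule A G with H ≠ ⊤, ∑ σ ∈ T,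
          (if IsRobust v m H ∧ ∀ i ∉ σ, v i ∈ H then f v else 0) := by
        have hnn : ∀ (v : ι → G) (H : Submodule A G) (σ : Finset ι),
            0 ≤ (if IsRobust v m H ∧ ∀ i ∉ σ, v i ∈ H then f v else 0) := by
          intro v H σ
          split_ifs
          exacts [hf v, le_rfl]
        rw [Finset.sum_filter]
        refine Finset.sum_le_sum fun v _ => ?_
        by_cases hv : IsRobust v m (⊤ : Submodule A G)
        · rw [if_neg (not_not.2 hv)]
          exact Finset.sum_nonneg fun H _ => Finset.sum_nonneg fun σ _ => hnn v H σ
        · rw [if_pos hv]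
          obtain ⟨H, hH, hr, σ, hσ, hmem⟩ := IsRobust.exists_of_not_top hv
          calc f v = if IsRobust v m H ∧ ∀ i ∉ σ, v i ∈ H then f v else 0 :=
                (if_pos ⟨hr, hmem⟩).symm
            _ ≤ ∑ σ ∈ T, (if IsRobust v m H ∧ ∀ i ∉ σ, v i ∈ H then f v else 0) :=
                Finset.single_le_sum (f := fun σ =>
                  if IsRobust v m H ∧ ∀ i ∉ σ, v i ∈ H then f v else 0)
                  (fun σ _ => hnn v H σ) (Finset.mem_filter.2 ⟨Finset.mem_univ _, hσ⟩)
            _ ≤ _ := Finset.single_le_sum (f := fun H : Submodule A G =>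
                  ∑ σ ∈ T, if IsRobust v m H ∧ ∀ i ∉ σ, v i ∈ H then f v else 0)
                  (fun H _ => Finset.sum_nonneg fun σ _ => hnn v H σ) (by simp [hH])
    _ = ∑ H : Submodule A G with H ≠ ⊤, ∑ σ ∈ T, ∑ v : ι → G,
          (if IsRobust v m H ∧ ∀ i ∉ σ, v i ∈ H then f v else 0) := by
        rw [Finset.sum_comm]
        exact Finset.sum_congr rfl fun H _ => Finset.sum_comm
    _ ≤ ∑ H : Submodule A G with H ≠ ⊤, smallSetSum ι (Nat.card G) (m * Nat.card G) * B := by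
        refine Finset.sum_le_sum fun H hH => ?_
        rw [smallSetSum, Finset.sum_mul]
        exact Finset.sum_le_sum fun σ _ => hterm H (Finset.mem_filter.1 hH).2 σ
    _ ≤ ∑ H : Submodule A G, smallSetSum ι (Nat.card G) (m * Nat.card G) * B :=
        Finset.sum_le_sum_of_subset_of_nonneg (Finset.filter_subset _ _) fun _ _ _ =>
          mul_nonneg (Finset.sum_nonneg fun _ _ => by positivity) hB0
    _ = _ := by
        rw [Finset.sum_const, nsmul_eq_mul, Finset.card_univ, ← Nat.card_eq_fintype_card]

end Robust

/-! ### Exponential decay against the entropy of small sets -/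

section Decay

lemma smallSetSum_nonneg (ι : Type*) [Fintype ι] (q M : ℕ) : 0 ≤ smallSetSum ι q M :=
  Finset.sum_nonneg fun _ _ => by positivity

/-- Chernoff's trick: `z ^ M ≤ z ^ σ.card` on the sets counted, after which the sum extends to all
subsets and the binomial theorem applies. -/
lemma smallSetSum_mul_pow_le (ι : Type*) [Fintype ι] (q M : ℕ) {z : ℝ} (hz0 : 0 ≤ z) (hz1 : z ≤ 1) :
    smallSetSum ι q M * z ^ M ≤ (q * z + 1) ^ Fintype.card ι := by
  rw [← Fintype.sum_pow_mul_eq_add_pow, smallSetSum, Finset.sum_mul]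
  calc ∑ σ : Finset ι with σ.card ≤ M, (q : ℝ) ^ σ.card * z ^ M
      ≤ ∑ σ : Finset ι with σ.card ≤ M, (q * z) ^ σ.card * 1 ^ (Fintype.card ι - σ.card) := by
        refine Finset.sum_le_sum fun σ hσ => ?_
        rw [one_pow, mul_one, mul_pow]
        gcongr ?_ * ?_
        exact pow_le_pow_of_le_one hz0 hz1 (Finset.mem_filter.1 hσ).2
    _ ≤ _ := Finset.sum_le_sum_of_subset_of_nonneg (Finset.filter_subset _ _)
        fun _ _ _ => by positivity

lemma exists_tendsto_smallSetSum_mul_pow (q : ℕ) {r : ℝ} (hr0 : 0 ≤ r) (hr1 : r < 1) :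
    ∃ K : ℕ, K ≠ 0 ∧
      Tendsto (fun n : ℕ => smallSetSum (Fin n) q (n / K * q) * r ^ n) atTop (𝓝 0) := by
  -- Small enough that `(q * z + 1) * r` stays below the midpoint `s` of `r` and 1.
  set z : ℝ := (1 - r) / (2 * (q + 1)) with hz
  have hz0 : 0 < z := by
    have : 0 < 1 - r := by linarith
    positivity
  have hqz : (q : ℝ) * z ≤ (1 - r) / 2 := by
    have h1 : ((q : ℝ) + 1) * z = (1 - r) / 2 := by
      rw [hz]
      field_simp
    linarith
  have hz1 : z ≤ 1 := by
    rw [hz, div_le_one (by positivity)]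
    have : (0 : ℝ) ≤ q := Nat.cast_nonneg q
    linarith
  set s : ℝ := (1 + r) / 2 with hs
  have hs0 : 0 < s := by linarith
  have hs1 : s < 1 := by linarith
  have hrs : (q * z + 1) * r ≤ s := by nlinarith
  -- Each block of `K` indices gains `s ^ K` and pays `z ^ q` for undoing the trick; `K` makes the
  -- net ratio less than 1.
  obtain ⟨K, hK⟩ := exists_pow_lt_of_lt_one (pow_pos hz0 q) hs1
  have hK0 : K ≠ 0 := by
    rintro rfl
    rw [pow_zero] at hK
    exact absurd hK (not_lt.2 (pow_le_one₀ hz0.le hz1))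
  refine ⟨K, hK0, ?_⟩
  have hlim : Tendsto (fun n : ℕ => (s ^ K / z ^ q) ^ (n / K)) atTop (𝓝 0) :=
    (tendsto_pow_atTop_nhds_zero_of_lt_one (by positivity)
      ((div_lt_one (pow_pos hz0 q)).2 hK)).comp (Nat.tendsto_div_const_atTop hK0)
  refine squeeze_zero (fun n => mul_nonneg (smallSetSum_nonneg _ _ _) (pow_nonneg hr0 n))
    (fun n => ?_) hlim
  have h1 := smallSetSum_mul_pow_le (Fin n) q (n / K * q) hz0.le hz1
  rw [Fintype.card_fin] at h1
  rw [div_pow, le_div_iff₀ (by positivity), ← pow_mul, mul_comm q, mul_right_comm]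
  calc smallSetSum (Fin n) q (n / K * q) * z ^ (n / K * q) * r ^ n
      ≤ (q * z + 1) ^ n * r ^ n := by gcongr
    _ = ((q * z + 1) * r) ^ n := (mul_pow _ _ _).symm
    _ ≤ s ^ n := by gcongr
    _ ≤ s ^ (K * (n / K)) := pow_le_pow_of_le_one hs0.le hs1.le (Nat.mul_div_le n K)
    _ = (s ^ K) ^ (n / K) := pow_mul _ _ _

lemma tendsto_mul_pow_div {c : ℝ} (hc0 : 0 ≤ c) (hc1 : c < 1) {K : ℕ} (hK : K ≠ 0) :
    Tendsto (fun n : ℕ => (n : ℝ) * c ^ (n / K)) atTop (𝓝 0) := by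
  have h1 : Tendsto (fun u : ℕ => (K : ℝ) * ((u : ℝ) * c ^ u + c ^ u)) atTop (𝓝 0) := by
    have := ((tendsto_self_mul_const_pow_of_lt_one hc0 hc1).add
      (tendsto_pow_atTop_nhds_zero_of_lt_one hc0 hc1)).const_mul (K : ℝ)
    simpa using this
  refine squeeze_zero (fun n => by positivity) (fun n => ?_)
    (h1.comp (Nat.tendsto_div_const_atTop hK))
  have h2 : (n : ℝ) ≤ K * ((n / K : ℕ) + 1) := by
    exact_mod_cast (Nat.lt_mul_div_succ n (Nat.pos_of_ne_zero hK)).le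
  calc (n : ℝ) * c ^ (n / K) ≤ K * ((n / K : ℕ) + 1) * c ^ (n / K) := by gcongr
    _ = _ := by simp only [Function.comp]; ring

end Decay

/-! ### The main estimate and its limit -/

section Limit

variable {p k : ℕ} [Fact p.Prime] {hk : k ≠ 0} {ε : ℝ}
  {G : Type*} [AddCommGroup G] [Module (ZMod (p ^ k)) G] [Fintype G]

open scoped Classical in
/-- The expected number of generating tuples `v` with `v X = T v`, for a random matrix `X` whose
column `j` has independent entries with laws `w j i`. -/
lemma abs_sum_prod_combProb_sub_one_le {ι : Type*} [Fintype ι] [DecidableEq ι] {c : ℝ}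
    (hc0 : 0 ≤ c) (hc1 : c ≤ 1)
    (hc : ∀ w : ZMod (p ^ k) → ℝ, BalancedWeight hk ε w →
      ∀ χ : AddChar (ZMod (p ^ k)) ℂ, χ ≠ 1 → ‖∑ a, (w a : ℂ) * χ a‖ ≤ c)
    {w : ι → ι → ZMod (p ^ k) → ℝ} (hw : ∀ j i, BalancedWeight hk ε (w j i)) (T : G → G) (m : ℕ)
    {r : ℝ} (hr : 1 / 2 ≤ r) (hmr : 1 - ε + Nat.card G * c ^ m ≤ r) :
    |∑ v : ι → G with Submodule.span (ZMod (p ^ k)) (Set.range v) = ⊤,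
        ∏ j, combProb (w j) v {T (v j)} - 1| ≤
      (Real.exp (Nat.card G * (Fintype.card ι * c ^ m)) - 1) +
      2 * (Nat.card (Submodule (ZMod (p ^ k)) G) *
        (smallSetSum ι (Nat.card G) (m * Nat.card G) * r ^ Fintype.card ι)) := by
  set q : ℝ := (Nat.card G : ℝ) with hq
  have hq0 : 0 < q := Nat.cast_pos.2 Nat.card_pos
  set F : (ι → G) → ℝ := fun v => ∏ j, combProb (w j) v {T (v j)} with hF
  have hF0 : ∀ v, 0 ≤ F v := fun v =>
    Finset.prod_nonneg fun j _ => combProb_nonneg (fun i => (hw j i).nonneg) _ _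
  have hr0 : 0 ≤ r := by linarith
  set gens : Finset (ι → G) :=
    Finset.univ.filter fun v => Submodule.span (ZMod (p ^ k)) (Set.range v) = ⊤ with hgens
  set good : Finset (ι → G) :=
    Finset.univ.filter fun v => IsRobust v m (⊤ : Submodule (ZMod (p ^ k)) G) with hgood
  set N := Fintype.card ι with hN
  set E : ℝ := (Nat.card (Submodule (ZMod (p ^ k)) G) : ℝ) *
        (smallSetSum ι (Nat.card G) (m * Nat.card G) * r ^ N) with hE
  -- tuples that are not robust are negligible, both in number and in contribution
  have hbad1 : ∑ v : ι → G with ¬ IsRobust v m (⊤ : Submodule (ZMod (p ^ k)) G), (q ^ N)⁻¹ ≤ E := by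
    refine sum_not_isRobust_le m (fun _ => (q ^ N)⁻¹) (fun _ => by positivity) (by positivity)
      fun H v hH _ => ?_
    rw [← div_eq_mul_inv, ← div_pow]
    refine pow_le_pow_left₀ (by positivity) (le_trans ?_ hr) N
    rw [div_le_iff₀ hq0]
    -- A proper subgroup has index at least 2, whence the requirement `1 / 2 ≤ r`.
    have h1 : Nat.card H ∣ Nat.card G := H.toAddSubgroup.card_addSubgroup_dvd_card
    obtain ⟨d, hd⟩ := h1
    have hd2 : 2 ≤ d := by
      by_contra! hlt
      have hpos : 0 < Nat.card G := Nat.card_pos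
      have hd1 : d = 1 := by
        interval_cases d
        · omega
        · rfl
      rw [hd1, mul_one] at hd
      apply hH
      have := AddSubgroup.eq_top_of_card_eq H.toAddSubgroup hd.symm
      exact Submodule.toAddSubgroup_injective this
    have : q = Nat.card H * d := by rw [hq, hd, Nat.cast_mul]
    have hd2' : (2 : ℝ) ≤ d := by exact_mod_cast hd2
    have hH0 : (0 : ℝ) ≤ Nat.card H := Nat.cast_nonneg _
    nlinarith
  have hbad2 : ∑ v : ι → G with ¬ IsRobust v m (⊤ : Submodule (ZMod (p ^ k)) G),
      (if v ∈ gens then F v else 0) ≤ E := by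
    refine sum_not_isRobust_le m (fun v => if v ∈ gens then F v else 0) (fun v => ?_)
      (by positivity) fun H v hH hrob => ?_
    · split_ifs
      exacts [hF0 v, le_rfl]
    · split_ifs with hv
      swap
      · rw [mul_zero]
        positivity
      have hHpos : (0 : ℝ) < Nat.card H := Nat.cast_pos.2 Nat.card_pos
      have hHq : (Nat.card H : ℝ) ≤ q :=
        Nat.cast_le.2 (Nat.card_le_card_of_injective _ Subtype.val_injective)
      -- An entry outside the proper submodule `H` supplies the factor `1 - ε` on top of `1 / |H|`.
      obtain ⟨i, hi⟩ : ∃ i, v i ∉ H := by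
        by_contra! hall
        apply hH
        rw [← top_le_iff, ← (Finset.mem_filter.1 hv).2, Submodule.span_le]
        rintro _ ⟨i, rfl⟩
        exact hall i
      rw [hN, ← Finset.card_univ, ← Finset.prod_const, ← Finset.prod_const,
        ← Finset.prod_mul_distrib]
      refine Finset.prod_le_prod (fun j _ => mul_nonneg hHpos.le
        (combProb_nonneg (fun i => (hw j i).nonneg) _ _)) fun j _ => ?_
      have h1 := abs_combProb_sub_le hc0 hc1 hc (hw j) v H.toAddSubgroup m
        (fun χ hχ => hrob.le_card_apply_ne_one χ hχ) (T (v j))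
      have h2 := combProb_coset_le (hw j) v H hi (T (v j))
      have h3 := (abs_le.1 h1).2
      simp only [Submodule.mem_toAddSubgroup] at h3
      change combProb (w j) v {T (v j)} - (Nat.card H : ℝ)⁻¹ * _ ≤ _ at h3
      calc (Nat.card H : ℝ) * combProb (w j) v {T (v j)}
          ≤ Nat.card H * ((Nat.card H : ℝ)⁻¹ * (1 - ε) + c ^ m) := by
            gcongr
            have : (Nat.card H : ℝ)⁻¹ * combProb (w j) v {y | y - T (v j) ∈ H} ≤
              (Nat.card H : ℝ)⁻¹ * (1 - ε) := by gcongr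
            linarith
        _ = 1 - ε + Nat.card H * c ^ m := by field_simp
        _ ≤ 1 - ε + q * c ^ m := by gcongr
        _ ≤ r := hmr
  have hgoodF : ∀ v ∈ good, |F v - (q ^ N)⁻¹| ≤ (q ^ N)⁻¹ * (Real.exp (q * (N * c ^ m)) - 1) := by
    intro v hv
    have hrob := (Finset.mem_filter.1 hv).2
    have hfac : ∀ j, |q * combProb (w j) v {T (v j)} - 1| ≤ q * c ^ m := by
      intro j
      have h1 := abs_combProb_sub_le hc0 hc1 hc (hw j) v
        (⊤ : Submodule (ZMod (p ^ k)) G).toAddSubgroup m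
        (fun χ hχ => hrob.le_card_apply_ne_one χ hχ) (T (v j))
      have h2 : {y : G | y - T (v j) ∈ (⊤ : Submodule (ZMod (p ^ k)) G).toAddSubgroup} =
          Set.univ := by
        ext; simp
      have h3 : Nat.card (⊤ : Submodule (ZMod (p ^ k)) G).toAddSubgroup = Nat.card G := by
        rw [Submodule.top_toAddSubgroup, AddSubgroup.card_top]
      rw [h2, combProb_univ (hw j), h3, mul_one] at h1
      calc |q * combProb (w j) v {T (v j)} - 1|
          = q * |combProb (w j) v {T (v j)} - q⁻¹| := by
            rw [← abs_of_pos hq0, ← abs_mul, abs_of_pos hq0, mul_sub, mul_inv_cancel₀ hq0.ne']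
        _ ≤ q * c ^ m := by gcongr
    -- A product of factors `1 + a j` differs from 1 by at most `exp (∑ |a j|) - 1`.
    have h4 := Finset.norm_prod_one_add_sub_one_le Finset.univ
      (fun j => q * combProb (w j) v {T (v j)} - 1)
    simp only [add_sub_cancel, Real.norm_eq_abs] at h4
    rw [Finset.prod_mul_distrib, Finset.prod_const, Finset.card_univ] at h4
    have h5 : ∑ j, |q * combProb (w j) v {T (v j)} - 1| ≤ q * (N * c ^ m) := by
      refine (Finset.sum_le_sum fun j _ => hfac j).trans_eq ?_
      rw [Finset.sum_const, nsmul_eq_mul, Finset.card_univ]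
      ring
    have h6 : F v - (q ^ N)⁻¹ = (q ^ N)⁻¹ * (q ^ N * F v - 1) := by
      field_simp
    rw [h6, abs_mul, abs_of_pos (by positivity)]
    gcongr
    exact h4.trans (by gcongr)
  have hcount : ∑ v : ι → G, (q ^ N)⁻¹ = 1 := by
    rw [Finset.sum_const, nsmul_eq_mul, Finset.card_univ, Fintype.card_fun, hq,
      Nat.card_eq_fintype_card, Nat.cast_pow]
    exact mul_inv_cancel₀ (by positivity)
  have hcard : (good.card : ℝ) * (q ^ N)⁻¹ ≤ 1 := by
    rw [← nsmul_eq_mul, ← Finset.sum_const, ← hcount]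
    exact Finset.sum_le_sum_of_subset_of_nonneg (Finset.filter_subset _ _)
      fun _ _ _ => by positivity
  have hexp : 0 ≤ Real.exp (q * (N * c ^ m)) - 1 := by
    have := Real.add_one_le_exp (q * (N * c ^ m))
    have : 0 ≤ q * (N * c ^ m) := by positivity
    linarith
  have hmain : |∑ v ∈ good, F v - ∑ v ∈ good, (q ^ N)⁻¹| ≤ Real.exp (q * (N * c ^ m)) - 1 := by
    rw [← Finset.sum_sub_distrib]
    calc |∑ v ∈ good, (F v - (q ^ N)⁻¹)|
        ≤ ∑ v ∈ good, (q ^ N)⁻¹ * (Real.exp (q * (N * c ^ m)) - 1) :=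
          (Finset.abs_sum_le_sum_abs _ _).trans (Finset.sum_le_sum hgoodF)
      _ = (good.card * (q ^ N)⁻¹) * (Real.exp (q * (N * c ^ m)) - 1) := by
          rw [Finset.sum_const, nsmul_eq_mul, mul_assoc]
      _ ≤ _ := mul_le_of_le_one_left hexp hcard
  have hsplit1 := Finset.sum_filter_add_sum_filter_not Finset.univ
    (fun v : ι → G => IsRobust v m (⊤ : Submodule (ZMod (p ^ k)) G)) (fun _ => (q ^ N)⁻¹)
  have hsplit2 := Finset.sum_filter_add_sum_filter_not Finset.univ
    (fun v : ι → G => IsRobust v m (⊤ : Submodule (ZMod (p ^ k)) G))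
    (fun v => if v ∈ gens then F v else 0)
  have hgens_sum : ∑ v : ι → G, (if v ∈ gens then F v else 0) = ∑ v ∈ gens, F v := by
    rw [Finset.sum_ite_mem, Finset.univ_inter]
  have hgood_sum : ∑ v ∈ good, (if v ∈ gens then F v else 0) = ∑ v ∈ good, F v :=
    Finset.sum_congr rfl fun v hv => if_pos (by
      rw [hgens, Finset.mem_filter]
      exact ⟨Finset.mem_univ _, (Finset.mem_filter.1 hv).2.span_range_eq_top⟩)
  have hnn1 : 0 ≤ ∑ v : ι → G with ¬ IsRobust v m (⊤ : Submodule (ZMod (p ^ k)) G), (q ^ N)⁻¹ :=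
    Finset.sum_nonneg fun _ _ => by positivity
  have hnn2 : 0 ≤ ∑ v : ι → G with ¬ IsRobust v m (⊤ : Submodule (ZMod (p ^ k)) G),
      (if v ∈ gens then F v else 0) := by
    refine Finset.sum_nonneg fun v _ => ?_
    split_ifs
    exacts [hF0 v, le_rfl]
  rw [hcount] at hsplit1
  rw [hgens_sum, hgood_sum] at hsplit2
  -- Non-robust tuples cost `E` twice: once as uniform mass missing from 1, once as their own
  -- contribution.
  rw [abs_le] at hmain ⊢
  constructor <;> linarith [hmain.1, hmain.2]

open scoped Classical in
lemma tendsto_sum_prod_combProb (hk : k ≠ 0) (hε0 : 0 < ε)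
    {w : (n : ℕ) → Fin n → Fin n → ZMod (p ^ k) → ℝ}
    (hw : ∀ n j i, BalancedWeight hk ε (w n j i)) (T : G → G) :
    Tendsto (fun n : ℕ =>
      ∑ v : Fin n → G with Submodule.span (ZMod (p ^ k)) (Set.range v) = ⊤,
        ∏ j, combProb (w n j) v {T (v j)}) atTop (𝓝 1) := by
  obtain ⟨c, hc0, hc1, hc⟩ := BalancedWeight.exists_norm_le p k hk hε0
  -- The slack `ε / 2` absorbs the Fourier error `|G| * c ^ (n / K)` for large `n`.
  set r : ℝ := max (1 / 2) (1 - ε / 2) with hr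
  have hr1 : r < 1 := max_lt (by norm_num) (by linarith)
  have hr2 : 1 / 2 ≤ r := le_max_left _ _
  obtain ⟨K, hK, hlim⟩ := exists_tendsto_smallSetSum_mul_pow (Nat.card G)
    (by linarith : 0 ≤ r) hr1
  have h1 := ((tendsto_mul_pow_div hc0 hc1 hK).const_mul (Nat.card G : ℝ)).rexp.sub_const 1
  have h2 := (hlim.const_mul (Nat.card (Submodule (ZMod (p ^ k)) G) : ℝ)).const_mul 2
  have h3 := h1.add h2
  simp only [mul_zero, Real.exp_zero, sub_self, add_zero] at h3
  have h4 : ∀ᶠ n : ℕ in atTop, (Nat.card G : ℝ) * c ^ (n / K) < ε / 2 := by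
    have := ((tendsto_pow_atTop_nhds_zero_of_lt_one hc0 hc1).comp
      (Nat.tendsto_div_const_atTop hK)).const_mul (Nat.card G : ℝ)
    rw [mul_zero] at this
    exact this.eventually (gt_mem_nhds (by positivity))
  rw [tendsto_iff_norm_sub_tendsto_zero]
  refine squeeze_zero' (Eventually.of_forall fun _ => norm_nonneg _) ?_ h3
  filter_upwards [h4] with n hn
  have h5 := abs_sum_prod_combProb_sub_one_le hc0 hc1.le hc (hw n) T (n / K) hr2
    (by have := le_max_right (1 / 2 : ℝ) (1 - ε / 2); rw [← hr] at this; linarith)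
  rw [Fintype.card_fin] at h5
  exact h5

end Limit

/-! ### Surjections from the cokernel as generating tuples -/

section Algebra

variable {A : Type*} [CommRing A] {P : A[X]} {G : Type*} [AddCommGroup G] [Module A G]
  [Module (AdjoinRoot P) G] [IsScalarTower A (AdjoinRoot P) G]

lemma AdjoinRoot.smul_mem_of_root_smul_mem {S : Submodule A G}
    (hS : ∀ g ∈ S, AdjoinRoot.root P • g ∈ S) (r : AdjoinRoot P) {g : G} (hg : g ∈ S) :
    r • g ∈ S := by
  induction r using AdjoinRoot.induction_on with
  | ih f =>
    induction f using Polynomial.induction_on' with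
    | add f₁ f₂ h₁ h₂ =>
      rw [map_add, add_smul]
      exact S.add_mem h₁ h₂
    | monomial n a =>
      have hpow : ∀ n : ℕ, AdjoinRoot.root P ^ n • g ∈ S := by
        intro n
        induction n with
        | zero => simpa using hg
        | succ n ih =>
          rw [pow_succ', mul_smul]
          exact hS _ ih
      rw [← C_mul_X_pow_eq_monomial, map_mul, map_pow, AdjoinRoot.mk_X, AdjoinRoot.mk_C,
        ← AdjoinRoot.algebraMap_eq, ← Algebra.smul_def, smul_assoc]
      exact S.smul_mem a (hpow n)

variable {n : ℕ} (X : Matrix (Fin n) (Fin n) A)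

lemma Matrix.sum_subRoot_smul (v : Fin n → G) (j : Fin n) :
    ∑ i, X.subRoot P i j • v i = ∑ i, X i j • v i - AdjoinRoot.root P • v j := by
  have h : ∀ i, X.subRoot P i j • v i =
      X i j • v i - if i = j then AdjoinRoot.root P • v i else 0 := by
    intro i
    rw [Matrix.subRoot, Matrix.sub_apply, Matrix.map_apply, Matrix.smul_apply, Matrix.one_apply,
      sub_smul, ← AdjoinRoot.algebraMap_eq, algebraMap_smul]
    split_ifs <;> simp
  simp only [h, Finset.sum_sub_distrib, Finset.sum_ite_eq', Finset.mem_univ, if_true]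

lemma Matrix.range_mulVecLin_le_ker_iff {R : Type*} [CommRing R] [Module R G]
    (Y : Matrix (Fin n) (Fin n) R) (v : Fin n → G) :
    LinearMap.range Y.mulVecLin ≤ LinearMap.ker (Fintype.linearCombination R v) ↔
      ∀ j, ∑ i, Y i j • v i = 0 := by
  rw [LinearMap.range_le_ker_iff]
  constructor
  · intro h j
    have := LinearMap.congr_fun h (Pi.single j 1)
    simpa [Fintype.linearCombination_apply] using this
  · intro h
    refine LinearMap.pi_ext' fun j => LinearMap.ext_ring ?_
    simpa [Fintype.linearCombination_apply] using h j

/-- By `hv`, the root sends each `v j` into the `A`-span of the tuple, so that span is already an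
`AdjoinRoot P`-submodule. -/
lemma span_range_eq_top_iff_of_sum_smul_eq {v : Fin n → G}
    (hv : ∀ j, ∑ i, X i j • v i = AdjoinRoot.root P • v j) :
    Submodule.span (AdjoinRoot P) (Set.range v) = ⊤ ↔ Submodule.span A (Set.range v) = ⊤ := by
  constructor
  · intro h
    have hS : ∀ g ∈ Submodule.span A (Set.range v),
        AdjoinRoot.root P • g ∈ Submodule.span A (Set.range v) := by
      intro g hg
      induction hg using Submodule.span_induction with
      | mem x hx =>
        obtain ⟨j, rfl⟩ := hx
        rw [← hv j]
        exact Submodule.sum_mem _ fun i _ =>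
          Submodule.smul_mem _ _ (Submodule.subset_span ⟨i, rfl⟩)
      | zero => rw [smul_zero]; exact Submodule.zero_mem _
      | add x y _ _ hx hy => rw [smul_add]; exact Submodule.add_mem _ hx hy
      | smul a x _ hx => rw [smul_comm]; exact Submodule.smul_mem _ _ hx
    rw [eq_top_iff]
    intro g _
    have hg : g ∈ Submodule.span (AdjoinRoot P) (Set.range v) := h ▸ Submodule.mem_top
    induction hg using Submodule.span_induction with
    | mem x hx => exact Submodule.subset_span hx
    | zero => exact Submodule.zero_mem _
    | add x y _ _ hx hy => exact Submodule.add_mem _ (hx trivial) (hy trivial)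
    | smul r x _ hx => exact AdjoinRoot.smul_mem_of_root_smul_mem hS r (hx trivial)
  · intro h
    rw [eq_top_iff]
    intro g _
    have hg : g ∈ Submodule.span A (Set.range v) := h ▸ Submodule.mem_top
    exact Submodule.span_le_restrictScalars A (AdjoinRoot P) _ hg

/-- A surjection from the cokernel of `X - t̄` onto `G` is a tuple generating `G` over the base ring
on which `X` acts as `t̄`. -/
lemma surjCount_cok_subRoot :
    surjCount (AdjoinRoot P) (X.subRoot P).Cok G =
      Nat.card {v : Fin n → G // Submodule.span A (Set.range v) = ⊤ ∧
        ∀ j, ∑ i, X i j • v i = AdjoinRoot.root P • v j} := by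
  have heq : ∀ v : Fin n → G, LinearMap.range (X.subRoot P).mulVecLin ≤
      LinearMap.ker (Fintype.linearCombination (AdjoinRoot P) v) ↔
      ∀ j, ∑ i, X i j • v i = AdjoinRoot.root P • v j := by
    intro v
    simp only [Matrix.range_mulVecLin_le_ker_iff, Matrix.sum_subRoot_smul, sub_eq_zero]
  let π := (LinearMap.range (X.subRoot P).mulVecLin).mkQ
  have hcomb : ∀ f : (X.subRoot P).Cok →ₗ[AdjoinRoot P] G,
      Fintype.linearCombination (AdjoinRoot P) (fun i => f (π (Pi.single i 1))) = f ∘ₗ π := by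
    intro f
    refine LinearMap.pi_ext' fun j => LinearMap.ext_ring ?_
    simp
  refine Nat.card_congr
    { toFun := fun f => ⟨fun i => f.1 (π (Pi.single i 1)), ?_⟩
      invFun := fun v => ⟨Submodule.liftQ _ (Fintype.linearCombination (AdjoinRoot P) v.1)
        ((heq v.1).2 v.2.2), ?_⟩
      left_inv := fun f => ?_
      right_inv := fun v => ?_ }
  · have h1 : ∀ j, ∑ i, X i j • f.1 (π (Pi.single i 1)) =
        AdjoinRoot.root P • f.1 (π (Pi.single j 1)) := by
      refine (heq _).1 ?_
      rw [hcomb]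
      refine le_trans (le_of_eq ?_) (LinearMap.ker_le_ker_comp _ _)
      exact (Submodule.ker_mkQ _).symm
    refine ⟨(span_range_eq_top_iff_of_sum_smul_eq X h1).1 ?_, h1⟩
    rw [← Fintype.range_linearCombination, hcomb, LinearMap.range_eq_top]
    exact f.2.comp (Submodule.mkQ_surjective _)
  · rw [← LinearMap.range_eq_top, Submodule.range_liftQ, Fintype.range_linearCombination]
    exact (span_range_eq_top_iff_of_sum_smul_eq X v.2.2).2 v.2.1
  · refine Subtype.ext (Submodule.linearMap_qext _ ?_)
    rw [Submodule.liftQ_mkQ]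
    exact hcomb f.1
  · refine Subtype.ext (funext fun i => ?_)
    simp [π]

end Algebra

/-! ### From measures on matrices to weights -/

section Expectation

variable {p k n : ℕ} [Fact p.Prime] {hk : k ≠ 0} {ε : ℝ}
  {μ : Measure (Matrix (Fin n) (Fin n) (ZMod (p ^ k)))}

lemma IsBalanced.balancedWeight {ν : Measure (ZMod (p ^ k))} (hν : IsBalanced hk ε ν) :
    BalancedWeight hk ε (fun a => ν.real {a}) := by
  have := hν.isProbabilityMeasure
  refine ⟨fun a => measureReal_nonneg, ?_, fun r => ?_⟩
  · rw [sum_measureReal_singleton, Finset.coe_univ, probReal_univ]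
  · rw [sum_measureReal_singleton]
    rw [Finset.coe_filter_univ]
    exact hν.residue_le r

lemma IsBalancedMatrix.real_singleton (hμ : IsBalancedMatrix hk ε μ)
    (X : Matrix (Fin n) (Fin n) (ZMod (p ^ k))) :
    μ.real {X} = ∏ j, ∏ i, (μ.map (fun Y : Matrix (Fin n) (Fin n) (ZMod (p ^ k)) => Y i j)).real
      {X i j} := by
  have h1 := hμ.indep.measure_inter_preimage_eq_mul Finset.univ
    (sets := fun ij => {X ij.1 ij.2}) (fun _ _ => measurableSet_singleton _)
  have h2 : (⋂ ij ∈ (Finset.univ : Finset (Fin n × Fin n)),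
      (fun Y : Matrix (Fin n) (Fin n) (ZMod (p ^ k)) => Y ij.1 ij.2) ⁻¹' {X ij.1 ij.2}) = {X} := by
    ext Y
    simp only [Finset.mem_univ, Set.iInter_true, Set.mem_iInter, Set.mem_preimage,
      Set.mem_singleton_iff, Prod.forall]
    exact ⟨fun h => Matrix.ext h, fun h i j => h ▸ rfl⟩
  rw [h2] at h1
  rw [measureReal_def, h1, ENNReal.toReal_prod, ← Finset.univ_product_univ,
    Finset.prod_product_right]
  refine Finset.prod_congr rfl fun j _ => Finset.prod_congr rfl fun i _ => ?_
  rw [measureReal_def, Measure.map_apply .of_discrete (measurableSet_singleton _)]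

open scoped Classical in
-- Linearity of expectation: for fixed `v`, the `j`-th condition involves only column `j`, and the
-- columns are independent.
lemma IsBalancedMatrix.integral_card_eq {G : Type*} [AddCommGroup G] [Module (ZMod (p ^ k)) G]
    [Fintype G] (hμ : IsBalancedMatrix hk ε μ) (S : Set (Fin n → G)) (T : G → G) :
    ∫ X, (Nat.card {v : Fin n → G // v ∈ S ∧ ∀ j, ∑ i, X i j • v i = T (v j)} : ℝ) ∂μ =
      ∑ v : Fin n → G with v ∈ S, ∏ j, combProb
        (fun i a => (μ.map (fun Y : Matrix (Fin n) (Fin n) (ZMod (p ^ k)) => Y i j)).real {a})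
        v {T (v j)} := by
  have := hμ.isProbabilityMeasure
  rw [integral_fintype (.of_finite)]
  have hcard : ∀ X : Matrix (Fin n) (Fin n) (ZMod (p ^ k)),
      (Nat.card {v : Fin n → G // v ∈ S ∧ ∀ j, ∑ i, X i j • v i = T (v j)} : ℝ) =
        ∑ v : Fin n → G with v ∈ S, if ∀ j, ∑ i, X i j • v i = T (v j) then 1 else 0 := by
    intro X
    rw [Nat.card_eq_fintype_card, Fintype.card_subtype, Finset.sum_boole, Finset.filter_filter]
  simp only [hcard, smul_eq_mul, Finset.mul_sum]
  rw [Finset.sum_comm]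
  refine Finset.sum_congr rfl fun v _ => ?_
  simp only [combProb]
  rw [Finset.prod_univ_sum]
  simp only [mul_ite, mul_one, mul_zero]
  rw [← Finset.sum_filter]
  -- The expanded product lists entries column first, so the bijection is transposition.
  refine Finset.sum_bij' (fun X _ => fun j i => X i j) (fun x _ => Matrix.of fun i j => x j i)
    ?_ ?_ ?_ ?_ ?_
  · intro X hX
    simpa using hX
  · intro x hx
    simpa using hx
  · intro X _
    rfl
  · intro x _
    rfl
  · intro X _
    exact hμ.real_singleton X

end Expectation

theorem mainTheorem2 (p : ℕ) [Fact p.Prime] (k : ℕ) (hk : k ≠ 0)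
    (P : (ZMod (p ^ k))[X]) (hP : P.Monic)
    (G : Type*) [AddCommGroup G] [Module (AdjoinRoot P) G] [Finite G]
    (ε : ℝ) (hε0 : 0 < ε) (hε1 : ε < 1)
    (μ : (n : ℕ) → Measure (Matrix (Fin n) (Fin n) (ZMod (p ^ k))))
    (hμ : ∀ n, IsBalancedMatrix hk ε (μ n)) :
    Tendsto (fun n : ℕ => ∫ X, (surjCount (AdjoinRoot P) (X.subRoot P).Cok G : ℝ) ∂(μ n))
      atTop (𝓝 1) := by
  classical
  let _ : Module (ZMod (p ^ k)) G := Module.compHom G (algebraMap (ZMod (p ^ k)) (AdjoinRoot P))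
  have : IsScalarTower (ZMod (p ^ k)) (AdjoinRoot P) G := ⟨fun a r g => by
    rw [Algebra.smul_def, mul_smul]
    rfl⟩
  have := Fintype.ofFinite G
  refine (tendsto_sum_prod_combProb hk hε0
    (fun n j i => ((hμ n).balanced i j).balancedWeight)
    (fun g : G => AdjoinRoot.root P • g)).congr fun n => ?_
  simp only [surjCount_cok_subRoot]
  exact ((hμ n).integral_card_eq
    {v | Submodule.span (ZMod (p ^ k)) (Set.range v) = ⊤} _).symm
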